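/- All groups are finite. For a finite group $G$ let $\mathrm{Irr}(G)$ be the set of complex irreducible characters of $G$. For $\chi\in\mathrm{Irr}(G)$ with kernel $\ker\chi=\{g\in G:\chi(g)=\chi(1)\}$ let $\mathrm{cod}(\chi)=|G:\ker\chi|/\chi(1)$ be its codegree, and put $$S_c(G)=\sum_{\chi\in\mathrm{Irr}(G)}\mathrm{cod}(\chi),\qquad \mathrm{fcod}(G)=\frac{S_c(G)}{|G|}.$$ **Proposition.** (1) There are families of solvable groups $\{G\}$ and $\{H\}$ such that $\mathrm{fcod}(G)\to 0$ as $|G|\to\infty$, and $\mathrm{fcod}(H)\to\infty$ as $|H|\to\infty$. Specifically, let $S=C_8\rtimes \mathrm{Aut}(C_8)\cong C_8\rtimes C_2^2$ be the holomorph of the cyclic group of order $8$ (SmallGroup(32,43)). The direct powers $S^n$, $n\ge 1$, are solvable, and $|S^n|\to\infty$ and $\mathrm{fcod}(S^n)\to 0$ as $n\to\infty$. The dihedral groups $D_{2^n}$ of order $2^n$, $n\ge 3$, are solvable, and $|D_{2^n}|\to\infty$ and $\mathrm{fcod}(D_{2^n})\to\infty$ as $n\to\infty$. (2) There are families of non-solvable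 groups $\{G\}$ and $\{H\}$ such that $\mathrm{fcod}(G)\to 0$ as $|G|\to\infty$, and $\mathrm{fcod}(H)\to\infty$ as $|H|\to\infty$. Specifically, the direct powers $A_6^n$, $n\ge 1$, of the alternating group $A_6$ are non-solvable, and $|A_6^n|\to\infty$ and $\mathrm{fcod}(A_6^n)\to 0$ as $n\to\infty$. The groups $A_5\times C_p$, with $p>5$ prime, are non-solvable, and $|A_5\times C_p|\to\infty$ and $\mathrm{fcod}(A_5\times C_p)\to\infty$ as $p\to\infty$ through the primes. -/

import Mathlib

open Filter Topology

/-- `Irr(G)`: the set of complex irreducible characters of `G`, as functions `G → ℂ`.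
Every finite-dimensional complex representation is isomorphic to one on some `ℂ^d`. -/
def Irr (G : Type*) [Group G] : Set (G → ℂ) :=
  {χ | ∃ (d : ℕ) (ρ : Representation ℂ G (Fin d → ℂ)), ρ.IsIrreducible ∧ ρ.character = χ}

/-- The kernel `{g | χ(g) = χ(1)}` of a character. -/
def charKer {G : Type*} [Group G] (χ : G → ℂ) : Set G :=
  {g | χ g = χ 1}

/-- The codegree `|G : ker χ| / χ(1)` of a character of a finite group, where
`|G : ker χ| = |G| / |ker χ|`. For a character, `χ 1` is a natural number, so taking its
real part loses nothing. -/
noncomputable def cod {G : Type*} [Group G] (χ : G → ℂ) : ℝ :=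
  ((Nat.card G : ℝ) / (charKer χ).ncard) / (χ 1).re

/-- A finite group has finitely many irreducible characters, so the sum below is a genuine one. -/
theorem Irr_finite (G : Type*) [Group G] [Finite G] : (Irr G).Finite := by
  classical
  cases nonempty_fintype G
  have hc : (Nat.card G : ℂ) ≠ 0 := Nat.cast_ne_zero.mpr Nat.card_pos.ne'
  let hi : Invertible (Nat.card G : ℂ) := invertibleOfNonzero hc
  let B : (G → ℂ) → (G → ℂ) → ℂ := fun χ ψ => (Nat.card G : ℂ)⁻¹ * ∑ g : G, χ g * ψ g⁻¹
  have hB : ∀ χ ∈ Irr G, ∀ ψ ∈ Irr G, B χ ψ = if χ = ψ then 1 else 0 := by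
    rintro _ ⟨d, ρ, hρ, rfl⟩ _ ⟨e, σ, hσ, rfl⟩
    have h := Representation.char_orthonormal ρ σ
    have h1 := Representation.char_orthonormal ρ ρ
    rw [if_pos ⟨Representation.Equiv.refl ρ⟩] at h1
    split_ifs with hχ
    · simp only [B]
      rw [← hχ]
      exact h1
    · rw [if_neg] at h
      · exact h
      · rintro ⟨φ⟩
        exact hχ (Representation.char_iso φ).symm
  have hli : LinearIndependent ℂ (fun χ : Irr G => (χ : G → ℂ)) := by
    rw [linearIndependent_iff']
    intro s c hs ψ hψ
    have h0 : B (∑ χ ∈ s, c χ • (χ : G → ℂ)) ψ = ∑ χ ∈ s, c χ * B χ ψ := by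
      simp only [B, Finset.sum_apply, Pi.smul_apply, smul_eq_mul, Finset.sum_mul, Finset.mul_sum]
      rw [Finset.sum_comm]
      refine Finset.sum_congr rfl fun χ _ => Finset.sum_congr rfl fun g _ => by ring
    rw [hs, Finset.sum_eq_single ψ, hB _ ψ.2 _ ψ.2, if_pos rfl] at h0
    · simpa [B] using h0.symm
    · intro χ _ hne
      rw [hB _ χ.2 _ ψ.2, if_neg (fun h => hne (Subtype.ext h)), mul_zero]
    · exact fun h => absurd hψ h
  exact hli.setFinite

/-- `S_c(G)`: the sum of the codegrees of the irreducible characters of `G`. -/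
noncomputable def codegreeSum (G : Type*) [Group G] [Finite G] : ℝ :=
  ∑ χ ∈ (Irr_finite G).toFinset, cod χ

/-- `fcod(G) = S_c(G) / |G|`. -/
noncomputable def fcod (G : Type*) [Group G] [Finite G] : ℝ :=
  codegreeSum G / Nat.card G

/-- The holomorph `C₈ ⋊ Aut(C₈) ≅ C₈ ⋊ C₂²` of the cyclic group of order `8`. It has order `32`
and is number 43 among the groups of order `32` in the Small Groups Library. -/
abbrev HolC8 : Type :=
  Multiplicative (ZMod 8) ⋊[MonoidHom.id (MulAut (Multiplicative (ZMod 8)))]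
    MulAut (Multiplicative (ZMod 8))

instance : Finite HolC8 := Finite.of_equiv _ SemidirectProduct.equivProd.symm

instance (p : {p : ℕ // p.Prime ∧ 5 < p}) : NeZero (p : ℕ) := ⟨p.2.1.ne_zero⟩

/-! Dividing a codegree by |G| leaves 1 / (|ker χ| χ(1)), so `fcod` is the sum of these terms over
the irreducible characters (`fcod_eq_sum`). Both kinds of limit follow from this.

Decay: Irr(G × H) consists of the outer products χ ⊗ ψ, and ker(χ ⊗ ψ) contains ker χ × ker ψ. Hence
`fcod` is submultiplicative (`fcod_prod_le`), and powers of G tend to 0 once `fcod G < 1`. For the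
holomorph of C₈ the whole character table is computed. For A₆ the five rational characters are found
explicitly, and the two of degree 8 are controlled only through their sum
(`le_degree_of_cauchySchwarz_eq`).

Growth: a partial sum bounds `fcod` from below. The dihedral groups have many faithful characters of
degree 2, each contributing 1/2. G × C_p has p - 1 linear characters with kernel G, each
contributing 1/|G|.

Characters are recognised numerically: a virtual character of norm 1 and positive degree is
irreducible (`mem_Irr_of_charInner_self_eq_one`), and a list of irreducibles is complete when its
squared degrees sum to |G| (`irrFinset_eq_of_sum_sq`). No representation beyond permutation, linear
and dihedral ones is constructed. -/

/-- The bilinear form `|G|⁻¹ ∑ χ(g) ψ(g⁻¹)` on complex-valued functions. -/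
noncomputable def charInner {G : Type*} [Group G] [Fintype G] (χ ψ : G → ℂ) : ℂ :=
  (Nat.card G : ℂ)⁻¹ * ∑ g : G, χ g * ψ g⁻¹

/-- The additive group of virtual characters of `G`. -/
def virtualChar (G : Type*) [Group G] : AddSubgroup (G → ℂ) :=
  AddSubgroup.closure (Irr G)

/-- The finite set of irreducible characters. -/
noncomputable def irrFinset (G : Type*) [Group G] [Finite G] : Finset (G → ℂ) :=
  (Irr_finite G).toFinset

/-! ### Virtual characters and orthogonality -/

section

variable {G : Type*} [Group G]

theorem mem_irrFinset [Finite G] {χ : G → ℂ} : χ ∈ irrFinset G ↔ χ ∈ Irr G := by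
  simp [irrFinset]

theorem natCard_ne_zero_complex (G : Type*) [Group G] [Finite G] : (Nat.card G : ℂ) ≠ 0 :=
  Nat.cast_ne_zero.mpr Nat.card_pos.ne'

theorem charInner_comm [Fintype G] (χ ψ : G → ℂ) : charInner χ ψ = charInner ψ χ := by
  unfold charInner
  congr 1
  rw [← Equiv.sum_comp (Equiv.inv G)]
  simp [mul_comm]

theorem charInner_sum_left [Fintype G] {ι : Type*} (s : Finset ι) (c : ι → ℂ)
    (f : ι → G → ℂ) (ψ : G → ℂ) :
    charInner (∑ i ∈ s, c i • f i) ψ = ∑ i ∈ s, c i * charInner (f i) ψ := by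
  simp only [charInner, Finset.sum_apply, Pi.smul_apply, smul_eq_mul, Finset.sum_mul,
    Finset.mul_sum]
  rw [Finset.sum_comm]
  exact Finset.sum_congr rfl fun i _ => Finset.sum_congr rfl fun g _ => by ring

theorem charInner_irr [Fintype G] [DecidableEq (G → ℂ)] {χ ψ : G → ℂ} (hχ : χ ∈ Irr G)
    (hψ : ψ ∈ Irr G) : charInner χ ψ = if χ = ψ then 1 else 0 := by
  classical
  let hi : Invertible (Nat.card G : ℂ) := invertibleOfNonzero (natCard_ne_zero_complex G)
  obtain ⟨d, ρ, hρ, rfl⟩ := hχ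
  obtain ⟨e, σ, hσ, rfl⟩ := hψ
  have h := Representation.char_orthonormal ρ σ
  have h1 := Representation.char_orthonormal ρ ρ
  rw [if_pos ⟨Representation.Equiv.refl ρ⟩] at h1
  split_ifs with hχ
  · rw [← hχ]
    exact h1
  · rw [if_neg] at h
    · exact h
    · rintro ⟨φ⟩
      exact hχ (Representation.char_iso φ).symm

/-- Transport along a basis: `Irr` only quantifies over representations on `Fin d → ℂ`, while
subrepresentations live on other spaces. -/
theorem character_mem_Irr {V : Type*} [AddCommGroup V] [Module ℂ V] [FiniteDimensional ℂ V]
    (ρ : Representation ℂ G V) (h : ρ.IsIrreducible) : ρ.character ∈ Irr G := by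
  let e : V ≃ₗ[ℂ] (Fin (Module.finrank ℂ V) → ℂ) := (Module.finBasis ℂ V).equivFun
  let σ : Representation ℂ G (Fin (Module.finrank ℂ V) → ℂ) :=
    { toFun := fun g => e.conj (ρ g)
      map_one' := by
        rw [map_one]
        exact e.conj_id
      map_mul' := fun a b => by
        rw [map_mul]
        exact e.conj_comp (ρ b) (ρ a) }
  have hσ : ∀ g v, σ g (e v) = e (ρ g v) := fun g v => by
    change e.conj (ρ g) (e v) = _
    simp [LinearEquiv.conj_apply]
  have hσ' : ∀ g v, ρ g (e.symm v) = e.symm (σ g v) := fun g v => by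
    obtain ⟨w, rfl⟩ := e.surjective v
    rw [hσ]
    simp
  refine ⟨_, σ, ?_, ?_⟩
  · let o : Subrepresentation ρ ≃o Subrepresentation σ :=
      { toFun := fun W => ⟨W.toSubmodule.map e.toLinearMap, by
          rintro g _ ⟨w, hw, rfl⟩
          exact ⟨ρ g w, W.apply_mem_toSubmodule g hw, (hσ g w).symm⟩⟩
        invFun := fun W => ⟨W.toSubmodule.map e.symm.toLinearMap, by
          rintro g _ ⟨w, hw, rfl⟩
          exact ⟨σ g w, W.apply_mem_toSubmodule g hw, (hσ' g w).symm⟩⟩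
        left_inv := fun W => by
          apply Subrepresentation.toSubmodule_injective
          ext v
          simp
        right_inv := fun W => by
          apply Subrepresentation.toSubmodule_injective
          ext v
          simp
        map_rel_iff' := fun {W W'} => by
          exact Submodule.map_le_map_iff_of_injective e.injective W.toSubmodule W'.toSubmodule }
    exact (o.isSimpleOrder_iff).1 h
  · ext g
    exact LinearMap.trace_conj' (ρ g) e

theorem Irr_le_virtualChar : Irr G ⊆ virtualChar G := AddSubgroup.subset_closure

/-- Maschke's theorem and induction on dimension: a proper nonzero subrepresentation has an
invariant complement, and traces add. -/
theorem character_mem_virtualChar [Finite G] {V : Type*} [AddCommGroup V] [Module ℂ V]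
    [FiniteDimensional ℂ V] (ρ : Representation ℂ G V) : ρ.character ∈ virtualChar G := by
  induction hn : Module.finrank ℂ V using Nat.strong_induction_on generalizing V with
  | _ n ih =>
  cases nonempty_fintype G
  by_cases hs : Subsingleton V
  · have : ρ.character = 0 := by
      ext g
      have : ρ g = 0 := by ext v; exact Subsingleton.elim _ _
      simp [Representation.character, this]
    rw [this]
    exact zero_mem _
  by_cases hρ : ρ.IsIrreducible
  · exact Irr_le_virtualChar (character_mem_Irr ρ hρ)
  have hbt : (⊥ : Subrepresentation ρ) ≠ ⊤ := by
    intro h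
    apply hs
    have h2 : (⊥ : Submodule ℂ V) = ⊤ := congrArg Subrepresentation.toSubmodule h
    exact Submodule.subsingleton_iff ℂ |>.1 (subsingleton_of_bot_eq_top h2)
  have : ∃ W : Subrepresentation ρ, W ≠ ⊥ ∧ W ≠ ⊤ := by
    by_contra! hc
    refine hρ ?_
    have : Nontrivial (Subrepresentation ρ) := ⟨⊥, ⊤, hbt⟩
    exact ⟨fun W => or_iff_not_imp_left.2 (hc W)⟩
  obtain ⟨W, hW0, hW1⟩ := this
  have : NeZero (Nat.card G : ℂ) := ⟨natCard_ne_zero_complex G⟩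
  have hss : ρ.IsSemisimpleRepresentation := inferInstance
  obtain ⟨U, hU⟩ := exists_isCompl W
  have hc : IsCompl W.toSubmodule U.toSubmodule := by
    constructor
    · rw [disjoint_iff]
      have := hU.inf_eq_bot
      exact congrArg Subrepresentation.toSubmodule this
    · rw [codisjoint_iff]
      have := hU.sup_eq_top
      exact congrArg Subrepresentation.toSubmodule this
  have hsum : ρ.character = W.toRepresentation.character + U.toRepresentation.character := by
    ext g
    have h1 := LinearMap.trace_conj'
      ((W.toRepresentation g).prodMap (U.toRepresentation g))
      (Submodule.prodEquivOfIsCompl _ _ hc)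
    rw [LinearMap.trace_prodMap'] at h1
    rw [Pi.add_apply, Representation.character, Representation.character,
      Representation.character, ← h1]
    congr 1
    ext v
    obtain ⟨⟨a, b⟩, rfl⟩ := (Submodule.prodEquivOfIsCompl _ _ hc).surjective v
    rw [LinearEquiv.conj_apply_apply]
    simp [Subrepresentation.toRepresentation]
  have hlt : ∀ X : Subrepresentation ρ, X ≠ ⊤ → Module.finrank ℂ X.toSubmodule < n := by
    intro X hX
    rw [← hn]
    refine Submodule.finrank_lt fun h => hX ?_
    exact Subrepresentation.toSubmodule_injective h
  have hU1 : U ≠ ⊤ := by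
    rintro rfl
    exact hW0 (by simpa using hU.inf_eq_bot)
  rw [hsum]
  exact add_mem (ih _ (hlt W hW1) W.toRepresentation rfl) (ih _ (hlt U hU1) U.toRepresentation rfl)

theorem exists_eq_sum_of_mem_virtualChar [Finite G] {f : G → ℂ} (hf : f ∈ virtualChar G) :
    ∃ m : (G → ℂ) → ℤ, f = ∑ χ ∈ irrFinset G, (m χ : ℂ) • χ := by
  classical
  induction hf using AddSubgroup.closure_induction with
  | mem χ hχ =>
    refine ⟨fun ψ => if ψ = χ then 1 else 0, ?_⟩
    rw [Finset.sum_eq_single χ]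
    · simp
    · intro b _ hb
      simp [hb]
    · exact fun h => absurd (mem_irrFinset.2 hχ) h
  | zero => exact ⟨0, by simp⟩
  | add x y _ _ hx hy =>
    obtain ⟨m, hm⟩ := hx
    obtain ⟨l, hl⟩ := hy
    exact ⟨m + l, by rw [hm, hl]; simp [Finset.sum_add_distrib, add_smul]⟩
  | neg x _ hx =>
    obtain ⟨m, hm⟩ := hx
    exact ⟨-m, by rw [hm]; simp⟩

theorem charInner_sum_irr [Fintype G] (m : (G → ℂ) → ℂ) {ψ : G → ℂ} (hψ : ψ ∈ Irr G) :
    charInner (∑ χ ∈ irrFinset G, m χ • χ) ψ = m ψ := by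
  classical
  rw [charInner_sum_left, Finset.sum_eq_single ψ]
  · rw [charInner_irr hψ hψ, if_pos rfl, mul_one]
  · intro χ hχ hne
    rw [charInner_irr (mem_irrFinset.1 hχ) hψ, if_neg hne, mul_zero]
  · exact fun h => absurd (mem_irrFinset.2 hψ) h

theorem charInner_sum_sum_irr [Fintype G] (m l : (G → ℂ) → ℂ) :
    charInner (∑ χ ∈ irrFinset G, m χ • χ) (∑ χ ∈ irrFinset G, l χ • χ) =
      ∑ χ ∈ irrFinset G, m χ * l χ := by
  rw [charInner_comm, charInner_sum_left]
  refine Finset.sum_congr rfl fun χ hχ => ?_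
  rw [charInner_comm, charInner_sum_irr _ (mem_irrFinset.1 hχ), mul_comm]

theorem exists_eq_apply_one {χ : G → ℂ} (hχ : χ ∈ Irr G) : ∃ d : ℕ, 0 < d ∧ χ 1 = d := by
  obtain ⟨d, ρ, hρ, rfl⟩ := hχ
  refine ⟨d, Nat.pos_of_ne_zero ?_, by simp⟩
  rintro rfl
  have h : (⊥ : Subrepresentation ρ) = ⊤ :=
    Subrepresentation.toSubmodule_injective (Subsingleton.elim _ _)
  exact bot_ne_top h

/-- A virtual character of norm one and positive degree is an irreducible character. -/
theorem mem_Irr_of_charInner_self_eq_one [Fintype G] {f : G → ℂ} (hf : f ∈ virtualChar G)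
    (h1 : charInner f f = 1) (hpos : 0 < (f 1).re) : f ∈ Irr G := by
  classical
  obtain ⟨m, hm⟩ := exists_eq_sum_of_mem_virtualChar hf
  have h2 : ∑ χ ∈ irrFinset G, m χ * m χ = 1 := by
    have := charInner_sum_sum_irr (fun χ => (m χ : ℂ)) (fun χ => (m χ : ℂ))
    rw [← hm, h1] at this
    exact_mod_cast this.symm
  obtain ⟨χ, hχ, hne⟩ : ∃ χ ∈ irrFinset G, m χ ≠ 0 := by
    by_contra! hc
    rw [Finset.sum_eq_zero fun χ hχ => by rw [hc χ hχ, zero_mul]] at h2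
    exact zero_ne_one h2
  -- Integer squares summing to 1: one coefficient is ±1 and the others vanish. The positive degree
  -- then excludes the sign -1.
  have h3 := Finset.add_sum_erase _ (fun χ => m χ * m χ) hχ
  have h4 : 0 ≤ ∑ χ ∈ (irrFinset G).erase χ, m χ * m χ :=
    Finset.sum_nonneg fun _ _ => mul_self_nonneg _
  have h5 : 1 ≤ m χ * m χ := by
    have : 0 < m χ * m χ := mul_self_pos.2 hne
    omega
  simp only [h2] at h3
  have h6 : ∑ χ ∈ (irrFinset G).erase χ, m χ * m χ = 0 := by omega
  rw [Finset.sum_eq_zero_iff_of_nonneg fun _ _ => mul_self_nonneg _] at h6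
  have h7 : f = (m χ : ℂ) • χ := by
    rw [hm, ← Finset.add_sum_erase _ _ hχ, Finset.sum_eq_zero, add_zero]
    intro ψ hψ
    rw [mul_self_eq_zero.1 (h6 ψ hψ)]
    simp
  have h8 : m χ * m χ = 1 := by omega
  have hχ' := mem_irrFinset.1 hχ
  rcases mul_self_eq_one_iff.1 h8 with h | h
  · rw [h7, h]
    simpa using hχ'
  · obtain ⟨d, hd, hd'⟩ := exists_eq_apply_one hχ'
    rw [h7, h] at hpos
    simp only [Int.cast_neg, Int.cast_one, neg_smul, one_smul, Pi.neg_apply, hd',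
      Complex.neg_re, Complex.natCast_re, Left.neg_pos_iff] at hpos
    exact absurd hpos (Nat.cast_nonneg d).not_gt

theorem mul_mem_virtualChar [Finite G] {f h : G → ℂ} (hf : f ∈ virtualChar G)
    (hh : h ∈ virtualChar G) : f * h ∈ virtualChar G := by
  induction hf using AddSubgroup.closure_induction with
  | mem χ hχ =>
    induction hh using AddSubgroup.closure_induction with
    | mem ψ hψ =>
      obtain ⟨d, ρ, hρ, rfl⟩ := hχ
      obtain ⟨e, σ, hσ, rfl⟩ := hψ
      rw [← Representation.char_tensor]
      exact character_mem_virtualChar _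
    | zero => simp
    | add x y _ _ hx hy => rw [mul_add]; exact add_mem hx hy
    | neg x _ hx => rw [mul_neg]; exact neg_mem hx
  | zero => simp
  | add x y _ _ hx hy => rw [add_mul]; exact add_mem hx hy
  | neg x _ hx => rw [neg_mul]; exact neg_mem hx

theorem comp_mem_virtualChar [Finite G] {H : Type*} [Group H] (φ : G →* H) {f : H → ℂ}
    (hf : f ∈ virtualChar H) : f ∘ φ ∈ virtualChar G := by
  induction hf using AddSubgroup.closure_induction with
  | mem χ hχ =>
    obtain ⟨d, ρ, hρ, rfl⟩ := hχ
    exact character_mem_virtualChar (MonoidHom.comp ρ φ)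
  | zero => exact zero_mem _
  | add x y _ _ hx hy => exact add_mem hx hy
  | neg x _ hx => exact neg_mem hx

theorem matrix_trace_mem_virtualChar [Finite G] {n : Type*} [Fintype n] [DecidableEq n]
    (φ : G →* Matrix n n ℂ) : (fun g => (φ g).trace) ∈ virtualChar G := by
  have := character_mem_virtualChar
    ((Matrix.toLinAlgEquiv' (R := ℂ) (n := n)).toMonoidHom.comp φ : Representation ℂ G (n → ℂ))
  convert this using 2 with g
  exact (Matrix.trace_toLin'_eq (φ g)).symm

/-- A linear character is irreducible. -/
theorem linear_mem_Irr [Finite G] (φ : G →* ℂ) : (φ : G → ℂ) ∈ Irr G := by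
  cases nonempty_fintype G
  have h : (fun g => φ g) ∈ virtualChar G := by
    have := matrix_trace_mem_virtualChar
      ((Matrix.scalar Unit : ℂ →+* Matrix Unit Unit ℂ).toMonoidHom.comp φ)
    convert this using 2 with g
    simp [Matrix.trace]
  refine mem_Irr_of_charInner_self_eq_one h ?_ (by simp)
  have h1 : ∀ g : G, φ g * φ g⁻¹ = 1 := fun g => by rw [← map_mul, mul_inv_cancel, map_one]
  simp only [charInner, h1]
  simp

theorem card_fixedBy_mem_virtualChar [Finite G] (X : Type*) [Fintype X] [DecidableEq X]
    [MulAction G X] :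
    (fun g : G => ((Finset.univ.filter fun x : X => g • x = x).card : ℂ)) ∈ virtualChar G := by
  let φ : G →* Matrix X X ℂ :=
    { toFun := fun g => Matrix.of fun x y => if x = g • y then 1 else 0
      map_one' := by
        ext x y
        simp [Matrix.one_apply]
      map_mul' := fun a b => by
        ext x y
        simp [Matrix.mul_apply, mul_smul] }
  convert matrix_trace_mem_virtualChar φ using 2 with g
  simp [φ, Matrix.trace, eq_comm]

/-- The right side is the character of the regular representation, in which χ has multiplicity χ(1).
-/
theorem sum_irr_apply_one_mul [Fintype G] (g : G) [Decidable (g = 1)] :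
    ∑ χ ∈ irrFinset G, χ 1 * χ g = if g = 1 then (Nat.card G : ℂ) else 0 := by
  classical
  set δ : G → ℂ := fun g => if g = 1 then (Nat.card G : ℂ) else 0 with hδ
  have h : δ ∈ virtualChar G := by
    convert card_fixedBy_mem_virtualChar (G := G) G using 2 with g
    by_cases hg : g = 1
    · simp [hδ, hg]
    · simp [hδ, hg]
  obtain ⟨m, hm⟩ := exists_eq_sum_of_mem_virtualChar h
  have h2 : ∀ χ ∈ irrFinset G, (m χ : ℂ) = χ 1 := by
    intro χ hχ
    rw [← charInner_sum_irr (fun χ => (m χ : ℂ)) (mem_irrFinset.1 hχ), ← hm]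
    simp [charInner, hδ]
  have h3 := congrFun hm g
  rw [Finset.sum_apply] at h3
  simp only [hδ] at h3
  rw [← Finset.sum_congr rfl fun χ hχ => by rw [← h2 χ hχ]]
  simpa using h3.symm

end

/-! ### Degrees, kernels and direct products -/

section

variable {G : Type*} [Group G]

theorem sum_irr_sq [Finite G] : ∑ χ ∈ irrFinset G, (χ 1).re ^ 2 = Nat.card G := by
  classical
  cases nonempty_fintype G
  have h := sum_irr_apply_one_mul (1 : G)
  rw [if_pos rfl] at h
  have h2 := congrArg Complex.re h
  rw [Complex.re_sum, Complex.natCast_re] at h2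
  rw [← h2]
  refine Finset.sum_congr rfl fun χ hχ => ?_
  obtain ⟨d, -, hd⟩ := exists_eq_apply_one (mem_irrFinset.1 hχ)
  rw [hd, ← Nat.cast_mul, Complex.natCast_re, Complex.natCast_re]
  push_cast
  ring

theorem re_apply_one_pos {χ : G → ℂ} (hχ : χ ∈ Irr G) : 0 < (χ 1).re := by
  obtain ⟨d, hd0, hd⟩ := exists_eq_apply_one hχ
  rw [hd, Complex.natCast_re]
  exact_mod_cast hd0

theorem apply_one_ne_zero {χ : G → ℂ} (hχ : χ ∈ Irr G) : χ 1 ≠ 0 := fun h => by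
  simpa [h] using re_apply_one_pos hχ

theorem ofReal_re_apply_one {χ : G → ℂ} (hχ : χ ∈ Irr G) : ((χ 1).re : ℂ) = χ 1 := by
  obtain ⟨d, hd0, hd⟩ := exists_eq_apply_one hχ
  simp [hd]

theorem ncard_charKer_pos [Finite G] (χ : G → ℂ) : 0 < (charKer χ).ncard :=
  (Set.ncard_pos).2 ⟨1, rfl⟩

theorem fcod_eq_sum [Finite G] :
    fcod G = ∑ χ ∈ irrFinset G, 1 / ((charKer χ).ncard * (χ 1).re) := by
  have h : (Nat.card G : ℝ) ≠ 0 := Nat.cast_ne_zero.mpr Nat.card_pos.ne'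
  unfold fcod codegreeSum irrFinset
  rw [Finset.sum_div]
  refine Finset.sum_congr rfl fun χ _ => ?_
  rw [cod]
  field_simp

theorem fcod_nonneg [Finite G] : 0 ≤ fcod G := by
  rw [fcod_eq_sum]
  refine Finset.sum_nonneg fun χ hχ => ?_
  have := re_apply_one_pos (mem_irrFinset.1 hχ)
  positivity

theorem sum_le_fcod [Finite G] {s : Finset (G → ℂ)} (hs : ∀ χ ∈ s, χ ∈ Irr G) :
    ∑ χ ∈ s, 1 / ((charKer χ).ncard * (χ 1).re) ≤ fcod G := by
  rw [fcod_eq_sum]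
  refine Finset.sum_le_sum_of_subset_of_nonneg (fun χ h => mem_irrFinset.2 (hs χ h)) ?_
  intro χ hχ _
  have := re_apply_one_pos (mem_irrFinset.1 hχ)
  positivity

/-- A set of irreducible characters whose squared degrees sum to `|G|` is all of `Irr G`. -/
theorem irrFinset_eq_of_sum_sq [Finite G] {s : Finset (G → ℂ)} (hs : ∀ χ ∈ s, χ ∈ Irr G)
    (h : ∑ χ ∈ s, (χ 1).re ^ 2 = Nat.card G) : irrFinset G = s := by
  classical
  have hsub : s ⊆ irrFinset G := fun χ h => mem_irrFinset.2 (hs χ h)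
  have h2 := Finset.sum_sdiff (f := fun χ : G → ℂ => (χ 1).re ^ 2) hsub
  rw [h, sum_irr_sq, add_eq_right, Finset.sum_eq_zero_iff_of_nonneg fun _ _ => sq_nonneg _] at h2
  refine (Finset.Subset.antisymm hsub fun χ hχ => ?_).symm
  by_contra hc
  have h3 := h2 χ (Finset.mem_sdiff.2 ⟨hχ, hc⟩)
  have := re_apply_one_pos (mem_irrFinset.1 hχ)
  exact absurd h3 (by positivity)

theorem comp_mulEquiv_mem_Irr {H : Type*} [Group H] (e : G ≃* H) {χ : H → ℂ}
    (hχ : χ ∈ Irr H) : χ ∘ e ∈ Irr G := by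
  obtain ⟨d, ρ, hρ, rfl⟩ := hχ
  refine ⟨d, MonoidHom.comp ρ e.toMonoidHom, ?_, rfl⟩
  let o : Subrepresentation ρ ≃o
      Subrepresentation (MonoidHom.comp ρ e.toMonoidHom : Representation ℂ G (Fin d → ℂ)) :=
    { toFun := fun W => ⟨W.toSubmodule, fun g _ hv => W.apply_mem_toSubmodule (e g) hv⟩
      invFun := fun W => ⟨W.toSubmodule, fun g v hv => by
        simpa using W.apply_mem_toSubmodule (e.symm g) hv⟩
      left_inv := fun _ => rfl
      right_inv := fun _ => rfl
      map_rel_iff' := Iff.rfl }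
  exact o.isSimpleOrder_iff.1 hρ

theorem fcod_congr [Finite G] {H : Type*} [Group H] [Finite H] (e : G ≃* H) :
    fcod G = fcod H := by
  rw [fcod_eq_sum, fcod_eq_sum]
  refine Finset.sum_bij (fun χ _ => χ ∘ e.symm)
    (fun χ hχ => mem_irrFinset.2 (comp_mulEquiv_mem_Irr e.symm (mem_irrFinset.1 hχ))) ?_ ?_ ?_
  · intro a _ b _ h
    exact e.symm.surjective.injective_comp_right h
  · intro χ hχ
    refine ⟨χ ∘ e, mem_irrFinset.2 (comp_mulEquiv_mem_Irr e (mem_irrFinset.1 hχ)), ?_⟩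
    ext h
    simp
  · intro χ _
    have : charKer (χ ∘ e.symm) = e.symm ⁻¹' charKer χ := by
      ext h
      simp [charKer]
    rw [this, Set.ncard_preimage_of_injective_subset_range e.symm.injective (by simp)]
    simp

/-- The outer product `(g, h) ↦ χ(g) ψ(h)`. -/
def outerProd {H : Type*} (χ : G → ℂ) (ψ : H → ℂ) : G × H → ℂ := fun x => χ x.1 * ψ x.2

theorem outerProd_mem_Irr [Finite G] {H : Type*} [Group H] [Finite H] {χ : G → ℂ} {ψ : H → ℂ}
    (hχ : χ ∈ Irr G) (hψ : ψ ∈ Irr H) : outerProd χ ψ ∈ Irr (G × H) := by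
  classical
  cases nonempty_fintype G
  cases nonempty_fintype H
  refine mem_Irr_of_charInner_self_eq_one ?_ ?_ ?_
  · exact mul_mem_virtualChar
      (comp_mem_virtualChar (MonoidHom.fst G H) (Irr_le_virtualChar hχ))
      (comp_mem_virtualChar (MonoidHom.snd G H) (Irr_le_virtualChar hψ))
  · have h1 := charInner_irr hχ hχ
    have h2 := charInner_irr hψ hψ
    rw [if_pos rfl] at h1 h2
    have h3 : charInner (outerProd χ ψ) (outerProd χ ψ) = charInner χ χ * charInner ψ ψ := by
      unfold charInner
      rw [mul_mul_mul_comm, Finset.sum_mul_sum, Fintype.sum_prod_type, Nat.card_prod,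
        Nat.cast_mul, mul_inv]
      congr 1
      refine Finset.sum_congr rfl fun g _ => Finset.sum_congr rfl fun h _ => ?_
      simp only [outerProd, Prod.fst_inv, Prod.snd_inv]
      ring
    rw [h3, h1, h2, one_mul]
  · obtain ⟨d, hd0, hd⟩ := exists_eq_apply_one hχ
    obtain ⟨e, he0, he⟩ := exists_eq_apply_one hψ
    simp only [outerProd, Prod.fst_one, Prod.snd_one, hd, he]
    rw [← Nat.cast_mul, Complex.natCast_re]
    positivity

/-- Distinct irreducibles are orthogonal, hence not proportional. Restricting χ ⊗ ψ to a factor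
determines that factor up to a nonzero scalar, so this gives injectivity of the outer product. -/
theorem eq_of_eq_smul [Finite G] {χ χ' : G → ℂ} (hχ : χ ∈ Irr G) (hχ' : χ' ∈ Irr G) {c : ℂ}
    (hc : c ≠ 0) (h : χ = c • χ') : χ = χ' := by
  classical
  cases nonempty_fintype G
  by_contra hne
  have h1 := charInner_irr hχ hχ'
  have h2 := charInner_sum_left {()} (fun _ => c) (fun _ => χ') χ'
  simp only [Finset.sum_singleton] at h2
  rw [if_neg hne, h, h2, charInner_irr hχ' hχ', if_pos rfl, mul_one] at h1
  exact hc h1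

theorem outerProd_injOn [Finite G] {H : Type*} [Group H] [Finite H] :
    Set.InjOn (fun p : (G → ℂ) × (H → ℂ) => outerProd p.1 p.2) (Irr G ×ˢ Irr H) := by
  rintro ⟨χ, ψ⟩ ⟨hχ, hψ⟩ ⟨χ', ψ'⟩ ⟨hχ', hψ'⟩ h
  have h1 : χ = χ' := by
    refine eq_of_eq_smul hχ hχ' (div_ne_zero (apply_one_ne_zero hψ') (apply_one_ne_zero hψ)) ?_
    ext g
    have := congrFun h (g, 1)
    simp only [outerProd] at this
    rw [Pi.smul_apply, smul_eq_mul, div_mul_eq_mul_div, eq_div_iff (apply_one_ne_zero hψ), this, mul_comm]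
  have h2 : ψ = ψ' := by
    refine eq_of_eq_smul hψ hψ' (div_ne_zero (apply_one_ne_zero hχ') (apply_one_ne_zero hχ)) ?_
    ext g
    have := congrFun h (1, g)
    simp only [outerProd] at this
    rw [Pi.smul_apply, smul_eq_mul, div_mul_eq_mul_div, eq_div_iff (apply_one_ne_zero hχ), ← this, mul_comm]
  rw [h1, h2]

/-- Outer products exhaust Irr(G × H) because the sums of squared degrees multiply. Only an
inequality holds: the kernel of χ ⊗ ψ can exceed ker χ × ker ψ, when scalars from the two factors
cancel. -/
theorem fcod_prod_le [Finite G] {H : Type*} [Group H] [Finite H] :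
    fcod (G × H) ≤ fcod G * fcod H := by
  classical
  have hinj : Set.InjOn (fun p : (G → ℂ) × (H → ℂ) => outerProd p.1 p.2)
      ((irrFinset G ×ˢ irrFinset H : Finset _) : Set ((G → ℂ) × (H → ℂ))) := by
    refine outerProd_injOn.mono ?_
    rintro p hp
    rw [Finset.mem_coe, Finset.mem_product] at hp
    exact ⟨mem_irrFinset.1 hp.1, mem_irrFinset.1 hp.2⟩
  have hI : irrFinset (G × H) =
      (irrFinset G ×ˢ irrFinset H).image fun p => outerProd p.1 p.2 := by
    refine irrFinset_eq_of_sum_sq ?_ ?_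
    · intro θ hθ
      obtain ⟨⟨χ, ψ⟩, hp, rfl⟩ := Finset.mem_image.1 hθ
      rw [Finset.mem_product] at hp
      exact outerProd_mem_Irr (mem_irrFinset.1 hp.1) (mem_irrFinset.1 hp.2)
    · rw [Finset.sum_image hinj, Nat.card_prod, Nat.cast_mul, ← sum_irr_sq, ← sum_irr_sq,
        Finset.sum_mul_sum, ← Finset.sum_product']
      refine Finset.sum_congr rfl fun p hp => ?_
      rw [Finset.mem_product] at hp
      rw [outerProd, Prod.fst_one, Prod.snd_one,
        ← ofReal_re_apply_one (mem_irrFinset.1 hp.1), ← ofReal_re_apply_one (mem_irrFinset.1 hp.2),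
        ← Complex.ofReal_mul, Complex.ofReal_re, Complex.ofReal_re, Complex.ofReal_re, mul_pow]
  rw [fcod_eq_sum, hI, Finset.sum_image hinj, fcod_eq_sum, fcod_eq_sum, Finset.sum_mul_sum,
    ← Finset.sum_product']
  refine Finset.sum_le_sum fun p hp => ?_
  rw [Finset.mem_product] at hp
  have h1 := re_apply_one_pos (mem_irrFinset.1 hp.1)
  have h2 := re_apply_one_pos (mem_irrFinset.1 hp.2)
  have k1 := ncard_charKer_pos p.1
  have k2 := ncard_charKer_pos p.2
  have hk : (charKer p.1).ncard * (charKer p.2).ncard ≤ (charKer (outerProd p.1 p.2)).ncard := by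
    rw [← Set.ncard_prod]
    refine Set.ncard_le_ncard ?_
    rintro ⟨g, h⟩ ⟨hg, hh⟩
    simp only [charKer, Set.mem_ofPred_eq] at hg hh
    simp [charKer, outerProd, hg, hh]
  have hd : (outerProd p.1 p.2 1).re = (p.1 1).re * (p.2 1).re := by
    rw [outerProd, Prod.fst_one, Prod.snd_one,
        ← ofReal_re_apply_one (mem_irrFinset.1 hp.1), ← ofReal_re_apply_one (mem_irrFinset.1 hp.2),
        ← Complex.ofReal_mul, Complex.ofReal_re, Complex.ofReal_re, Complex.ofReal_re]
  rw [hd, div_mul_div_comm, one_mul, mul_mul_mul_comm]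
  refine one_div_le_one_div_of_le (by positivity) ?_
  gcongr
  exact_mod_cast hk

theorem fcod_pow_le [Finite G] (n : ℕ) : fcod (Fin (n + 1) → G) ≤ fcod G ^ (n + 1) := by
  induction n with
  | zero =>
    rw [fcod_congr (MulEquiv.funUnique (Fin 1) G), zero_add, pow_one]
  | succ n ih =>
    let e : (Fin (n + 1 + 1) → G) ≃* G × (Fin (n + 1) → G) :=
      { (Fin.consEquiv fun _ => G).symm with map_mul' := fun _ _ => rfl }
    rw [fcod_congr e, pow_succ']
    exact fcod_prod_le.trans (mul_le_mul_of_nonneg_left ih fcod_nonneg)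

theorem tendsto_fcod_pow [Finite G] (h : fcod G < 1) :
    Tendsto (fun n : ℕ => fcod (Fin (n + 1) → G)) atTop (𝓝 0) := by
  refine squeeze_zero (fun _ => fcod_nonneg) fcod_pow_le ?_
  exact (tendsto_pow_atTop_nhds_zero_of_lt_one fcod_nonneg h).comp (tendsto_add_atTop_nat 1)

end

theorem tendsto_card_pow {G : Type*} [Finite G] [Nontrivial G] :
    Tendsto (fun n : ℕ => Nat.card (Fin (n + 1) → G)) atTop atTop := by
  have h : ∀ n : ℕ, Nat.card (Fin (n + 1) → G) = Nat.card G ^ (n + 1) := fun n => by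
    rw [Nat.card_fun, Nat.card_fin]
  simp only [h]
  exact (tendsto_pow_atTop_atTop_of_one_lt Finite.one_lt_card).comp (tendsto_add_atTop_nat 1)

/-! ### Direct products with C_p -/

theorem tendsto_prime_val :
    Tendsto (fun p : {p : ℕ // p.Prime ∧ 5 < p} => (p : ℕ)) atTop atTop := by
  refine tendsto_atTop.2 fun b => ?_
  -- The shift by 6 makes q exceed 5 as well as b.
  obtain ⟨q, hq, hp⟩ := Nat.exists_infinite_primes (b + 6)
  have := eventually_ge_atTop (⟨q, hp, by omega⟩ : {p : ℕ // p.Prime ∧ 5 < p})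
  filter_upwards [this] with p hp'
  have h : q ≤ (p : ℕ) := hp'
  omega

theorem ZMod_stdAddChar_mul_eq_one_iff {N : ℕ} [NeZero N] (x : ZMod N) :
    ZMod.stdAddChar x = 1 ↔ x = 0 := by
  rw [← ZMod.injective_stdAddChar.eq_iff (a := x) (b := 0), AddChar.map_zero_eq_one]

/-- The linear character `(g, x) ↦ exp(2πi k x / p)` of `G × C_p`. -/
noncomputable def cyclicFactorChar (G : Type*) [Group G] (p : ℕ) [NeZero p] (k : ZMod p) :
    G × Multiplicative (ZMod p) →* ℂ where
  toFun x := ZMod.stdAddChar (k * x.2.toAdd)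
  map_one' := by simp
  map_mul' x y := by simp [mul_add, AddChar.map_add_eq_mul]

/-- For k ≠ 0 the character x ↦ exp(2πikx/p) is injective on C_p since p is prime, so its inflation
has kernel exactly G. -/
theorem le_fcod_prod_cyclic (G : Type*) [Group G] [Finite G] (p : ℕ) [NeZero p]
    (hp : p.Prime) :
    ((p : ℝ) - 1) / Nat.card G ≤ fcod (G × Multiplicative (ZMod p)) := by
  classical
  have : Fact p.Prime := ⟨hp⟩
  have hinj : Function.Injective
      fun k : ZMod p => (cyclicFactorChar G p k : G × Multiplicative (ZMod p) → ℂ) := by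
    intro k l h
    have := congrFun h (1, Multiplicative.ofAdd 1)
    simpa [cyclicFactorChar, ZMod.injective_stdAddChar.eq_iff] using this
  let s := (Finset.univ.erase (0 : ZMod p)).image
    fun k => (cyclicFactorChar G p k : G × Multiplicative (ZMod p) → ℂ)
  have hs : ∀ χ ∈ s, χ ∈ Irr (G × Multiplicative (ZMod p)) := by
    intro χ hχ
    obtain ⟨k, -, rfl⟩ := Finset.mem_image.1 hχ
    exact linear_mem_Irr _
  refine le_trans (le_of_eq ?_) (sum_le_fcod hs)
  rw [Finset.sum_image hinj.injOn]
  have h : ∀ k ∈ Finset.univ.erase (0 : ZMod p),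
      1 / (((charKer (cyclicFactorChar G p k)).ncard : ℝ) * (cyclicFactorChar G p k 1).re) =
        1 / Nat.card G := by
    intro k hk
    have hk0 : k ≠ 0 := Finset.ne_of_mem_erase hk
    have hker : charKer (cyclicFactorChar G p k) = Set.univ ×ˢ {1} := by
      ext ⟨g, x⟩
      rw [charKer, Set.mem_ofPred_eq, map_one]
      simp only [cyclicFactorChar, MonoidHom.coe_mk, OneHom.coe_mk,
        ZMod_stdAddChar_mul_eq_one_iff, mul_eq_zero, hk0, false_or, Set.mem_prod, Set.mem_univ,
        true_and, Set.mem_singleton_iff]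
      exact Iff.rfl
    rw [hker, Set.ncard_prod, Set.ncard_univ, Set.ncard_singleton, map_one]
    simp
  rw [Finset.sum_congr rfl h, Finset.sum_const, Finset.card_erase_of_mem (Finset.mem_univ _),
    Finset.card_univ, ZMod.card, nsmul_eq_mul, Nat.cast_sub hp.one_le]
  simp [div_eq_mul_inv]

theorem tendsto_fcod_prod_cyclic (G : Type*) [Group G] [Finite G] :
    Tendsto (fun p : {p : ℕ // p.Prime ∧ 5 < p} => fcod (G × Multiplicative (ZMod p)))
      atTop atTop := by
  refine tendsto_atTop_mono (fun p => le_fcod_prod_cyclic G p p.2.1) ?_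
  have h : (0 : ℝ) < Nat.card G := Nat.cast_pos.2 Nat.card_pos
  refine Tendsto.atTop_div_const h (tendsto_atTop_add_const_right _ _ ?_)
  exact tendsto_natCast_atTop_atTop.comp tendsto_prime_val

theorem tendsto_card_prod_cyclic (G : Type*) [Group G] [Finite G] :
    Tendsto (fun p : {p : ℕ // p.Prime ∧ 5 < p} => Nat.card (G × Multiplicative (ZMod p)))
      atTop atTop := by
  refine tendsto_atTop_mono (fun p => ?_) tendsto_prime_val
  rw [Nat.card_prod, Nat.card_eq_of_bijective _ Multiplicative.toAdd.bijective, Nat.card_zmod]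
  exact Nat.le_mul_of_pos_left _ Nat.card_pos

/-! ### Dihedral groups -/

section Dihedral

variable {N : ℕ}

/-- The two-dimensional matrix representation of the dihedral group induced by a character of the
rotation subgroup. -/
def dihedralMatrixHom (ψ : AddChar (ZMod N) ℂ) : DihedralGroup N →* Matrix (Fin 2) (Fin 2) ℂ where
  toFun
    | .r i => !![ψ i, 0; 0, ψ (-i)]
    | .sr i => !![0, ψ (-i); ψ i, 0]
  map_one' := by
    rw [DihedralGroup.one_def]
    ext i j
    fin_cases i <;> fin_cases j <;> simp
  map_mul' := by
    rintro (a | a) (b | b) <;> ext i j <;> fin_cases i <;> fin_cases j <;>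
      simp [← AddChar.map_add_eq_mul, sub_eq_add_neg, add_comm]

/-- The character of the induced representation of the dihedral group. -/
def dihedralChar (ψ : AddChar (ZMod N) ℂ) : DihedralGroup N → ℂ
  | .r i => ψ i + ψ (-i)
  | .sr _ => 0

theorem dihedralChar_one (ψ : AddChar (ZMod N) ℂ) : dihedralChar ψ 1 = 2 := by
  rw [DihedralGroup.one_def]
  simp [dihedralChar, one_add_one_eq_two]

/-- Reflections contribute nothing to the norm. A rotation contributes ψ²(i) + ψ²(-i) + 2, and the
nontrivial character ψ² sums to 0, leaving 2N / 2N = 1. -/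
theorem dihedralChar_mem_Irr [NeZero N] {ψ : AddChar (ZMod N) ℂ} (h : ψ * ψ ≠ 1) :
    dihedralChar ψ ∈ Irr (DihedralGroup N) := by
  refine mem_Irr_of_charInner_self_eq_one ?_ ?_ (by simp [dihedralChar_one])
  · convert matrix_trace_mem_virtualChar (dihedralMatrixHom ψ) using 2 with g
    rcases g with i | i <;> simp [dihedralChar, dihedralMatrixHom, Matrix.trace_fin_two]
  · have h0 : ∑ i, (ψ * ψ) i = 0 := AddChar.sum_eq_zero_of_ne_one h
    have h1 : ∑ i, (ψ * ψ) (-i) = 0 := by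
      rw [← h0]
      exact Equiv.sum_comp (Equiv.neg (ZMod N)) (fun i => (ψ * ψ) i)
    have h2 : ∀ i, ψ i * ψ (-i) = 1 := fun i => by
      rw [← AddChar.map_add_eq_mul, add_neg_cancel, AddChar.map_zero_eq_one]
    have h3 : ∑ g, dihedralChar ψ g * dihedralChar ψ g⁻¹ =
        ∑ i : ZMod N, ((ψ * ψ) i + (ψ * ψ) (-i) + 2) := by
      rw [← Equiv.sum_comp DihedralGroup.equivSum.symm, Fintype.sum_sum_type]
      simp only [DihedralGroup.equivSum, Equiv.coe_fn_symm_mk, DihedralGroup.inv_r,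
        DihedralGroup.inv_sr, dihedralChar, mul_zero, Finset.sum_const_zero, add_zero, neg_neg]
      refine Finset.sum_congr rfl fun i _ => ?_
      rw [AddChar.mul_apply, AddChar.mul_apply]
      linear_combination 2 * h2 i
    have hN : (N : ℂ) ≠ 0 := Nat.cast_ne_zero.2 (NeZero.ne N)
    rw [charInner, h3, Finset.sum_add_distrib, Finset.sum_add_distrib, h0, h1,
      DihedralGroup.nat_card]
    simp
    field_simp

theorem charKer_dihedralChar [NeZero N] {ψ : AddChar (ZMod N) ℂ} (h : Function.Injective ψ) :
    charKer (dihedralChar ψ) = {1} := by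
  ext g
  rw [charKer, Set.mem_ofPred_eq, Set.mem_singleton_iff]
  refine ⟨fun hg => ?_, fun hg => by rw [hg]⟩
  rw [dihedralChar_one] at hg
  rcases g with i | i
  · have h2 : ψ i * ψ (-i) = 1 := by
      rw [← AddChar.map_add_eq_mul, add_neg_cancel, AddChar.map_zero_eq_one]
    simp only [dihedralChar] at hg
    -- Two numbers with sum 2 and product 1 are both 1.
    have h3 : (ψ i - 1) ^ 2 = 0 := by linear_combination ψ i * hg - h2
    have h4 : ψ i = ψ 0 := by
      rw [AddChar.map_zero_eq_one]
      exact sub_eq_zero.1 (pow_eq_zero_iff two_ne_zero |>.1 h3)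
    rw [h h4, DihedralGroup.one_def]
  · simp [dihedralChar] at hg

/-- The value at the rotation `r 1` is the sum of two numbers with product 1, so it determines them
as the roots of a quadratic. -/
theorem eq_or_eq_neg_of_dihedralChar_eq {ψ φ : AddChar (ZMod N) ℂ}
    (h : dihedralChar ψ = dihedralChar φ) : ψ 1 = φ 1 ∨ ψ 1 = φ (-1) := by
  have h1 := congrFun h (.r 1)
  simp only [dihedralChar] at h1
  have h2 : ∀ θ : AddChar (ZMod N) ℂ, θ 1 * θ (-1) = 1 := fun θ => by
    rw [← AddChar.map_add_eq_mul, add_neg_cancel, AddChar.map_zero_eq_one]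
  have h3 : (ψ 1 - φ 1) * (ψ 1 - φ (-1)) = 0 := by
    linear_combination ψ 1 * h1 + h2 φ - h2 ψ
  rcases mul_eq_zero.1 h3 with h | h
  · exact Or.inl (sub_eq_zero.1 h)
  · exact Or.inr (sub_eq_zero.1 h)

/-- Odd multipliers give faithful ψ, and k and -k induce the same character. The 2ⁿ odd numbers
below N/2 represent each pair ±k once. -/
theorem le_fcod_dihedral (n : ℕ) : (2 : ℝ) ^ n / 2 ≤ fcod (DihedralGroup (2 ^ (n + 2))) := by
  classical
  set N := 2 ^ (n + 2) with hN
  have hN4 : N = 4 * 2 ^ n := by rw [hN, pow_add]; ring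
  have hpow : 0 < 2 ^ n := by positivity
  let ψ : ℕ → AddChar (ZMod N) ℂ := fun j => ZMod.stdAddChar.mulShift ((2 * j + 1 : ℕ) : ZMod N)
  have hψ : ∀ j i, ψ j i = ZMod.stdAddChar (((2 * j + 1 : ℕ) : ZMod N) * i) := fun j i => rfl
  have hunit : ∀ j, IsUnit ((2 * j + 1 : ℕ) : ZMod N) := fun j => by
    rw [ZMod.isUnit_iff_coprime, hN]
    exact Nat.Coprime.pow_right _ (by simp)
  have hψi : ∀ j, Function.Injective (ψ j) := fun j a b hab => by
    rw [hψ, hψ, ZMod.injective_stdAddChar.eq_iff] at hab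
    exact (hunit j).mul_left_cancel hab
  have hψ2 : ∀ j, ψ j * ψ j ≠ 1 := fun j h => by
    have h1 := DFunLike.congr_fun h 1
    rw [AddChar.mul_apply, ← AddChar.map_add_eq_mul, AddChar.one_apply,
      ← AddChar.map_zero_eq_one (ψ j)] at h1
    have h2 := hψi j h1
    have h3 : ((2 : ℕ) : ZMod N) = 0 := by rw [← h2]; norm_num
    rw [ZMod.natCast_eq_zero_iff] at h3
    have := Nat.le_of_dvd two_pos h3
    omega
  have hinj : Set.InjOn (fun j => dihedralChar (ψ j)) (Finset.range (2 ^ n) : Set ℕ) := by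
    intro a ha b hb hab
    rw [Finset.coe_range, Set.mem_Iio] at ha hb
    rcases eq_or_eq_neg_of_dihedralChar_eq hab with h | h
    · rw [hψ, hψ, ZMod.injective_stdAddChar.eq_iff, mul_one, mul_one, ZMod.natCast_eq_natCast_iff',
        Nat.mod_eq_of_lt (by omega), Nat.mod_eq_of_lt (by omega)] at h
      omega
    · rw [hψ, hψ, ZMod.injective_stdAddChar.eq_iff, mul_one, mul_neg, mul_one,
        eq_neg_iff_add_eq_zero, ← Nat.cast_add, ZMod.natCast_eq_zero_iff] at h
      -- The two multipliers add up to at most N - 2, so their sum is not divisible by N.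
      have := Nat.le_of_dvd (by omega) h
      omega
  have hs : ∀ χ ∈ (Finset.range (2 ^ n)).image fun j => dihedralChar (ψ j),
      χ ∈ Irr (DihedralGroup N) := by
    intro χ hχ
    obtain ⟨j, -, rfl⟩ := Finset.mem_image.1 hχ
    exact dihedralChar_mem_Irr (hψ2 j)
  refine le_trans (le_of_eq ?_) (sum_le_fcod hs)
  rw [Finset.sum_image hinj]
  simp only [charKer_dihedralChar (hψi _), dihedralChar_one]
  simp [div_eq_mul_inv]

theorem tendsto_fcod_dihedral :
    Tendsto (fun n : ℕ => fcod (DihedralGroup (2 ^ (n + 2)))) atTop atTop :=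
  tendsto_atTop_mono le_fcod_dihedral
    (Tendsto.atTop_div_const two_pos (tendsto_pow_atTop_atTop_of_one_lt one_lt_two))

theorem tendsto_card_dihedral :
    Tendsto (fun n : ℕ => Nat.card (DihedralGroup (2 ^ (n + 2)))) atTop atTop := by
  refine tendsto_atTop_mono (fun n => ?_) (tendsto_pow_atTop_atTop_of_one_lt one_lt_two)
  rw [DihedralGroup.nat_card, pow_add]
  omega

end Dihedral

/-! ### Solvability and orders -/

theorem isSolvable_of_card_eq_two_pow {G : Type*} [Group G] [Finite G] {n : ℕ}
    (h : Nat.card G = 2 ^ n) : Group.IsSolvable G := by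
  have : Fact (Nat.Prime 2) := ⟨Nat.prime_two⟩
  have := (IsPGroup.of_card h).isNilpotent
  infer_instance

/-- `DihedralGroup m` has order 2m, so the family starts at order 8 when n = 0. -/
theorem isSolvable_dihedral (n : ℕ) : Group.IsSolvable (DihedralGroup (2 ^ (n + 2))) :=
  isSolvable_of_card_eq_two_pow (n := n + 3) (by rw [DihedralGroup.nat_card]; ring)

theorem card_HolC8 : Nat.card HolC8 = 2 ^ 5 := by
  rw [SemidirectProduct.card, IsCyclic.card_mulAut,
    Nat.card_eq_of_bijective _ Multiplicative.toAdd.bijective, Nat.card_zmod]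
  decide

theorem isSolvable_pow_HolC8 (n : ℕ) : Group.IsSolvable (Fin (n + 1) → HolC8) :=
  isSolvable_of_card_eq_two_pow (n := 5 * (n + 1)) (by
    rw [Nat.card_fun, card_HolC8, Nat.card_fin, pow_mul])

/-- The symmetric group is an extension of the alternating group by an abelian group of signs, so it
would be solvable too. -/
theorem not_isSolvable_alternatingGroup {n : ℕ} (hn : 5 ≤ n) :
    ¬ Group.IsSolvable (alternatingGroup (Fin n)) := by
  intro h
  refine Equiv.Perm.not_isSolvable (Fin n) (by simpa using hn) ?_
  refine Group.isSolvable_of_ker_le_range (alternatingGroup (Fin n)).subtype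
    (Equiv.Perm.sign (α := Fin n)) ?_
  rw [Subgroup.range_subtype]
  exact le_of_eq rfl

theorem not_isSolvable_pow {G : Type*} [Group G] (h : ¬ Group.IsSolvable G) (n : ℕ) :
    ¬ Group.IsSolvable (Fin (n + 1) → G) := fun _ =>
  h (Group.isSolvable_of_surjective (f := Pi.evalMonoidHom (fun _ : Fin (n + 1) => G) 0)
    (Function.surjective_eval 0))

theorem not_isSolvable_prod {G H : Type*} [Group G] [Group H] (h : ¬ Group.IsSolvable G) :
    ¬ Group.IsSolvable (G × H) := fun _ =>
  h (Group.isSolvable_of_surjective (f := MonoidHom.fst G H) Prod.fst_surjective)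

/-! ### Integer-valued character tables -/

section

variable {G : Type*} [Group G]

theorem intCast_mem_Irr [Fintype G] {F : G → ℤ} (hF : (fun g => (F g : ℂ)) ∈ virtualChar G)
    (hnorm : ∑ g, F g * F g⁻¹ = Fintype.card G) (hpos : 0 < F 1) :
    (fun g => (F g : ℂ)) ∈ Irr G := by
  refine mem_Irr_of_charInner_self_eq_one hF ?_ (by simpa using hpos)
  have h : ∑ g, (F g : ℂ) * F g⁻¹ = Fintype.card G := by exact_mod_cast hnorm
  rw [charInner, h]
  simp

theorem ncard_charKer_intCast [Fintype G] (F : G → ℤ) :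
    (charKer fun g => (F g : ℂ)).ncard = (Finset.univ.filter fun g => F g = F 1).card := by
  rw [← Set.ncard_coe_finset]
  congr 1
  ext g
  simp [charKer]

/-- If all irreducible characters are given by a table of integer-valued functions, then `fcod` is
computed from the table. -/
theorem fcod_eq_of_table [Fintype G] {ι : Type*} [Fintype ι] {F : ι → G → ℤ}
    (hinj : Function.Injective F) (hF : ∀ i, (fun g => (F i g : ℂ)) ∈ Irr G)
    (hsum : ∑ i, F i 1 ^ 2 = Fintype.card G) :
    fcod G =
      ((∑ i, 1 / (((Finset.univ.filter fun g => F i g = F i 1).card : ℚ) * F i 1) : ℚ) : ℝ) := by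
  classical
  have hinj' : Function.Injective fun i => (fun g => (F i g : ℂ)) := fun i j h => by
    apply hinj
    ext g
    have h1 : (F i g : ℂ) = F j g := congrFun h g
    exact_mod_cast h1
  have h : irrFinset G = Finset.univ.image fun i => (fun g => (F i g : ℂ)) := by
    refine irrFinset_eq_of_sum_sq ?_ ?_
    · intro χ hχ
      obtain ⟨i, -, rfl⟩ := Finset.mem_image.1 hχ
      exact hF i
    · rw [Finset.sum_image hinj'.injOn]
      simp only [Complex.intCast_re]
      rw [Nat.card_eq_fintype_card]
      exact_mod_cast hsum
  rw [fcod_eq_sum, h, Finset.sum_image hinj'.injOn]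
  simp only [ncard_charKer_intCast, Complex.intCast_re]
  push_cast
  rfl

end

/-! ### The holomorph of C₈ -/

/-- The action of the units of `ℤ/8` on the cyclic group of order `8` by multiplication. -/
def unitsToMulAut : (ZMod 8)ˣ →* MulAut (Multiplicative (ZMod 8)) where
  toFun u :=
    { toFun := fun x => Multiplicative.ofAdd (u * x.toAdd)
      invFun := fun x => Multiplicative.ofAdd (u⁻¹ * x.toAdd)
      left_inv := fun x => by simp
      right_inv := fun x => by simp
      map_mul' := fun x y => by simp [mul_add] }
  map_one' := by ext; simp
  map_mul' u v := by ext; simp [mul_assoc]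

/-- The image of the generator recovers the unit, and both sides have φ(8) elements. -/
theorem unitsToMulAut_bijective : Function.Bijective unitsToMulAut := by
  have hinj : Function.Injective unitsToMulAut := by
    intro u v h
    have h1 := DFunLike.congr_fun h (Multiplicative.ofAdd 1)
    ext
    simpa [unitsToMulAut] using h1
  refine hinj.bijective_of_nat_card_le ?_
  rw [IsCyclic.card_mulAut, Nat.card_eq_of_bijective _ Multiplicative.toAdd.bijective,
    Nat.card_zmod, Nat.card_eq_fintype_card, ZMod.card_units_eq_totient]

/-- A computable model of the holomorph of the cyclic group of order `8`. -/
abbrev AffineZMod8 : Type := Multiplicative (ZMod 8) ⋊[unitsToMulAut] (ZMod 8)ˣ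

instance : Fintype AffineZMod8 := Fintype.ofEquiv _ SemidirectProduct.equivProd.symm

/-- The model is isomorphic to the holomorph of the cyclic group of order `8`. -/
noncomputable def holC8Equiv : AffineZMod8 ≃* HolC8 :=
  SemidirectProduct.congr (MulEquiv.refl _) (MulEquiv.ofBijective _ unitsToMulAut_bijective)
    fun _ => rfl

instance : DecidableEq AffineZMod8 := fun a b =>
  decidable_of_iff (a.left = b.left ∧ a.right = b.right) SemidirectProduct.ext_iff.symm

/-- The sign character `(i, u) ↦ (-1)^i`. -/
def paritySign : AffineZMod8 →* ℤ where
  toFun g := if g.left.toAdd.val % 2 = 0 then 1 else -1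
  map_one' := by decide +kernel
  map_mul' := by decide +kernel

/-- The sign character `(i, u) ↦ (-1/u)`. -/
def negOneSign : AffineZMod8 →* ℤ where
  toFun g := if (g.right : ZMod 8).val % 4 = 1 then 1 else -1
  map_one' := by decide +kernel
  map_mul' := by decide +kernel

/-- The sign character `(i, u) ↦ (2/u)`. -/
def twoSign : AffineZMod8 →* ℤ where
  toFun g := if (g.right : ZMod 8) = 1 ∨ (g.right : ZMod 8) = 7 then 1 else -1
  map_one' := by decide +kernel
  map_mul' := by decide +kernel

/-- The affine action of `AffineZMod8` on a quotient of `ℤ/8`. -/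
abbrev affineAction {R : Type*} [CommRing R] (f : ZMod 8 →+* R) : MulAction AffineZMod8 R where
  smul g x := f g.right * x + f g.left.toAdd
  one_smul x := by
    change f _ * x + f _ = x
    simp
  mul_smul g h x := by
    change f _ * x + f _ = f _ * (f _ * x + f _) + f _
    simp [unitsToMulAut]
    ring

/-- The permutation character of the affine action on a quotient of `ℤ/8`. -/
def affinePermChar {R : Type*} [CommRing R] [Fintype R] [DecidableEq R] (f : ZMod 8 →+* R)
    (g : AffineZMod8) : ℤ :=
  (Finset.univ.filter fun x : R => f g.right * x + f g.left.toAdd = x).card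

theorem affinePermChar_mem_virtualChar {R : Type*} [CommRing R] [Fintype R] [DecidableEq R]
    (f : ZMod 8 →+* R) : (fun g => (affinePermChar f g : ℂ)) ∈ virtualChar AffineZMod8 := by
  let := affineAction f
  convert card_fixedBy_mem_virtualChar (G := AffineZMod8) R using 2 with g
  rw [affinePermChar, Int.cast_natCast]
  rfl

/-- The irreducible character of degree two factoring through the dihedral group of order `8`. -/
def dihedralQuotChar (g : AffineZMod8) : ℤ :=
  affinePermChar (ZMod.castHom (by decide : 4 ∣ 8) (ZMod 4)) g - 1 - paritySign g

/-- The faithful irreducible character of degree four. -/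
def faithfulChar (g : AffineZMod8) : ℤ :=
  affinePermChar (RingHom.id (ZMod 8)) g -
    affinePermChar (ZMod.castHom (by decide : 4 ∣ 8) (ZMod 4)) g

/-- The irreducible characters of `AffineZMod8`. -/
def affineCharTable : (Fin 2 × Fin 2 × Fin 2) ⊕ Fin 2 ⊕ Unit → AffineZMod8 → ℤ
  | .inl (a, b, c) => fun g => paritySign g ^ (a : ℕ) * negOneSign g ^ (b : ℕ) *
      twoSign g ^ (c : ℕ)
  | .inr (.inl c) => fun g => dihedralQuotChar g * twoSign g ^ (c : ℕ)
  | .inr (.inr _) => faithfulChar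

theorem sign_pow_mem_virtualChar {G : Type*} [Group G] [Finite G] (φ : G →* ℤ) (n : ℕ) :
    (fun g => ((φ g ^ n : ℤ) : ℂ)) ∈ virtualChar G :=
  Irr_le_virtualChar (linear_mem_Irr ((Int.castRingHom ℂ).toMonoidHom.comp (φ ^ n)))

theorem intCast_mul_mem_virtualChar {G : Type*} [Group G] [Finite G] {F F' : G → ℤ}
    (h : (fun g => (F g : ℂ)) ∈ virtualChar G) (h' : (fun g => (F' g : ℂ)) ∈ virtualChar G) :
    (fun g => ((F g * F' g : ℤ) : ℂ)) ∈ virtualChar G := by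
  convert mul_mem_virtualChar h h' using 1
  ext g
  simp

theorem intCast_sub_mem_virtualChar {G : Type*} [Group G] {F F' : G → ℤ}
    (h : (fun g => (F g : ℂ)) ∈ virtualChar G) (h' : (fun g => (F' g : ℂ)) ∈ virtualChar G) :
    (fun g => ((F g - F' g : ℤ) : ℂ)) ∈ virtualChar G := by
  convert sub_mem h h' using 1
  ext g
  simp

theorem one_mem_virtualChar {G : Type*} [Group G] [Finite G] :
    (fun _ => ((1 : ℤ) : ℂ)) ∈ virtualChar G := by
  simpa using sign_pow_mem_virtualChar (1 : G →* ℤ) 1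

theorem affineCharTable_mem_virtualChar (i) :
    (fun g => (affineCharTable i g : ℂ)) ∈ virtualChar AffineZMod8 := by
  rcases i with ⟨a, b, c⟩ | c | _
  · exact intCast_mul_mem_virtualChar (intCast_mul_mem_virtualChar
      (sign_pow_mem_virtualChar _ _) (sign_pow_mem_virtualChar _ _)) (sign_pow_mem_virtualChar _ _)
  · refine intCast_mul_mem_virtualChar ?_ (sign_pow_mem_virtualChar _ _)
    refine intCast_sub_mem_virtualChar (intCast_sub_mem_virtualChar
      (affinePermChar_mem_virtualChar _) one_mem_virtualChar) ?_
    simpa using sign_pow_mem_virtualChar paritySign 1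
  · exact intCast_sub_mem_virtualChar
      (affinePermChar_mem_virtualChar _) (affinePermChar_mem_virtualChar _)

/-- The squared degrees are 8·1 + 2·4 + 16 = 32. The trivial character, the seven sign characters
with kernel of order 16, the two of degree 2 with kernel of order 4 and the faithful one give 1/32 +
7/16 + 2/8 + 1/4 = 31/32. -/
theorem fcod_HolC8_lt_one : fcod HolC8 < 1 := by
  rw [← fcod_congr holC8Equiv, fcod_eq_of_table (F := affineCharTable) (by decide +kernel)
    (fun i => intCast_mem_Irr (affineCharTable_mem_virtualChar i)
      (by revert i; decide +kernel) (by revert i; decide +kernel)) (by decide +kernel)]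
  -- Over ℚ the comparison is decidable by evaluation.
  have h : ∀ q : ℚ, q < 1 → (q : ℝ) < 1 := fun q hq => by exact_mod_cast hq
  refine h _ ?_
  decide +kernel

/-! ### Characters of A₆ -/

theorem apply_conj_of_mem_virtualChar {G : Type*} [Group G] {f : G → ℂ} (hf : f ∈ virtualChar G)
    (g h : G) : f (h * g * h⁻¹) = f g := by
  induction hf using AddSubgroup.closure_induction with
  | mem χ hχ =>
    obtain ⟨d, ρ, hρ, rfl⟩ := hχ
    exact ρ.char_conj g h
  | zero => rfl
  | add x y _ _ hx hy => rw [Pi.add_apply, Pi.add_apply, hx, hy]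
  | neg x _ hx => rw [Pi.neg_apply, Pi.neg_apply, hx]

/-- The number of `k`-element subsets fixed by a permutation. -/
def subsetFix {n : ℕ} (k : ℕ) (g : Equiv.Perm (Fin n)) : ℤ :=
  ((Finset.univ.powersetCard k).filter fun s => s.map g.toEmbedding = s).card

theorem subsetFix_mem_virtualChar (n k : ℕ) :
    (fun g : Equiv.Perm (Fin n) => (subsetFix k g : ℂ)) ∈ virtualChar (Equiv.Perm (Fin n)) := by
  let : MulAction (Equiv.Perm (Fin n)) {s : Finset (Fin n) // s.card = k} :=
    { smul := fun g s => ⟨s.1.map g.toEmbedding, by rw [Finset.card_map, s.2]⟩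
      one_smul := fun s => Subtype.ext (by
        change s.1.map _ = s.1
        ext x
        simp [Finset.mem_map_equiv]
        rfl)
      mul_smul := fun g h s => Subtype.ext (by
        change s.1.map _ = (s.1.map _).map _
        rw [Finset.map_map]
        rfl) }
  convert card_fixedBy_mem_virtualChar (G := Equiv.Perm (Fin n)) {s : Finset (Fin n) // s.card = k}
    using 2 with g
  rw [subsetFix, Int.cast_natCast, Nat.cast_inj]
  refine Finset.card_bij' (fun s hs => ⟨s, ?_⟩) (fun s _ => s.1) ?_ ?_ (fun _ _ => rfl)
    (fun _ _ => rfl)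
  · exact (Finset.mem_powersetCard.1 (Finset.mem_filter.1 hs).1).2
  · intro s hs
    exact Finset.mem_filter.2 ⟨Finset.mem_univ _, Subtype.ext (Finset.mem_filter.1 hs).2⟩
  · intro s hs
    exact Finset.mem_filter.2 ⟨Finset.mem_powersetCard.2 ⟨Finset.subset_univ _, s.2⟩,
      congrArg Subtype.val (Finset.mem_filter.1 hs).2⟩

/-- Representatives of the cycle types of even permutations of six points. -/
def evenCycleRep : Fin 6 → Equiv.Perm (Fin 6) :=
  ![1, c[0, 1] * c[2, 3], c[0, 1, 2], c[0, 1, 2] * c[3, 4, 5], c[0, 1, 2, 3] * c[4, 5],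
    c[0, 1, 2, 3, 4]]

/-- The numbers of even permutations of six points of each cycle type. -/
def evenCycleCount : Fin 6 → ℕ := ![1, 45, 40, 40, 90, 144]

/-- The cycle types of even permutations of six points. -/
def evenCycleType : Fin 6 → Multiset ℕ := ![0, {2, 2}, {3}, {3, 3}, {4, 2}, {5}]

theorem cycleType_evenCycleRep (i : Fin 6) : (evenCycleRep i).cycleType = evenCycleType i := by
  revert i
  decide +kernel

theorem card_cycleType_eq_evenCycleType (i : Fin 6) :
    (Finset.univ.filter fun g : alternatingGroup (Fin 6) =>
      (g : Equiv.Perm (Fin 6)).cycleType = evenCycleType i).card = evenCycleCount i := by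
  rw [AlternatingGroup.card_of_cycleType]
  revert i
  decide +kernel

theorem card_alternatingGroup_six : Fintype.card (alternatingGroup (Fin 6)) = 360 := by
  have h := two_mul_card_alternatingGroup (α := Fin 6)
  rw [Fintype.card_perm, Fintype.card_fin, show Nat.factorial 6 = 720 from rfl] at h
  omega

/-- Summation of a class function over the alternating group on six points. -/
theorem sum_alternatingGroup_six (F : Equiv.Perm (Fin 6) → ℤ)
    (hF : ∀ g h, F (h * g * h⁻¹) = F g) :
    ∑ g : alternatingGroup (Fin 6), F g = ∑ i, evenCycleCount i * F (evenCycleRep i) := by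
  classical
  let T : Fin 6 → Finset (alternatingGroup (Fin 6)) := fun i =>
    Finset.univ.filter fun g => (g : Equiv.Perm (Fin 6)).cycleType = evenCycleType i
  have hT : ∀ i g, g ∈ T i ↔ (g : Equiv.Perm (Fin 6)).cycleType = evenCycleType i := by
    simp [T]
  have hinj : Function.Injective evenCycleType := by decide +kernel
  have hdisj : Set.PairwiseDisjoint ((Finset.univ : Finset (Fin 6)) : Set (Fin 6)) T := by
    intro i _ j _ hij
    refine Finset.disjoint_left.2 fun g hi hj => hij (hinj ?_)
    rw [← (hT i g).1 hi, ← (hT j g).1 hj]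
  have hU : Finset.univ.biUnion T = Finset.univ := by
    -- The six counts add up to 360, so no even permutation is missed.
    refine Finset.eq_univ_of_card _ ?_
    rw [Finset.card_biUnion hdisj, card_alternatingGroup_six,
      Finset.sum_congr rfl fun i _ => card_cycleType_eq_evenCycleType i]
    rfl
  rw [← hU, Finset.sum_biUnion hdisj]
  refine Finset.sum_congr rfl fun i _ => ?_
  rw [← card_cycleType_eq_evenCycleType i, ← nsmul_eq_mul]
  refine Finset.sum_eq_card_nsmul fun g hg => ?_
  -- The conjugator lies in S₆ and need not be even. This merges the two A₆-classes of 5-cycles, so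
  -- six representatives suffice.
  obtain ⟨h, hh⟩ := isConj_iff.1 (Equiv.Perm.isConj_iff_cycleType_eq.2
    ((cycleType_evenCycleRep i).trans ((hT i g).1 hg).symm))
  rw [← hh, hF]

/-- Five irreducible characters of `A₆`, of degrees `1, 5, 5, 9, 10`. -/
def sixPointChar : Fin 5 → Equiv.Perm (Fin 6) → ℤ :=
  ![fun _ => 1,
    fun g => subsetFix 1 g - 1,
    fun g => subsetFix 3 g - subsetFix 2 g,
    fun g => subsetFix 2 g - subsetFix 1 g,
    fun g => (subsetFix 1 g - 1) * (subsetFix 1 g - 1) - subsetFix 2 g]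

/-- A virtual character of `A₆` which is the sum of the two irreducible characters of degree `8`. -/
def sixPointSumChar (g : Equiv.Perm (Fin 6)) : ℤ :=
  (subsetFix 1 g - 1) * (subsetFix 3 g - subsetFix 2 g) - (subsetFix 2 g - subsetFix 1 g)

/-- By Young's rule, differences of permutation characters on k-subsets are the characters of S₆ for
(5,1), (4,2) and (3,3). Removing the 2-subset character from the square of the (5,1) one leaves
(4,1,1). -/
theorem sixPointChar_mem_virtualChar (i : Fin 5) :
    (fun g => (sixPointChar i g : ℂ)) ∈ virtualChar (Equiv.Perm (Fin 6)) := by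
  have h := subsetFix_mem_virtualChar 6
  have h1 := one_mem_virtualChar (G := Equiv.Perm (Fin 6))
  have h5 := intCast_sub_mem_virtualChar (h 1) h1
  fin_cases i
  · exact h1
  · exact h5
  · exact intCast_sub_mem_virtualChar (h 3) (h 2)
  · exact intCast_sub_mem_virtualChar (h 2) (h 1)
  · exact intCast_sub_mem_virtualChar (intCast_mul_mem_virtualChar h5 h5) (h 2)

/-- The product of the (5,1) and (3,3) characters is (4,2) + (3,2,1), so this is the (3,2,1)
character. It splits on A₆ into two characters of degree 8 with irrational values, which an integer
table cannot hold. -/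
theorem sixPointSumChar_mem_virtualChar :
    (fun g => (sixPointSumChar g : ℂ)) ∈ virtualChar (Equiv.Perm (Fin 6)) :=
  intCast_sub_mem_virtualChar
    (intCast_mul_mem_virtualChar (sixPointChar_mem_virtualChar 1) (sixPointChar_mem_virtualChar 2))
    (sixPointChar_mem_virtualChar 3)

theorem sum_mul_inv_alternatingGroup_six {F F' : Equiv.Perm (Fin 6) → ℤ}
    (hF : (fun g => (F g : ℂ)) ∈ virtualChar (Equiv.Perm (Fin 6)))
    (hF' : (fun g => (F' g : ℂ)) ∈ virtualChar (Equiv.Perm (Fin 6))) :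
    ∑ g : alternatingGroup (Fin 6), F g * F' (g⁻¹ : alternatingGroup (Fin 6)) =
      ∑ i, evenCycleCount i * (F (evenCycleRep i) * F' (evenCycleRep i)⁻¹) := by
  refine sum_alternatingGroup_six (fun g => F g * F' g⁻¹) fun g h => ?_
  have h1 := apply_conj_of_mem_virtualChar hF g h
  have h2 := apply_conj_of_mem_virtualChar hF' g⁻¹ h
  rw [show (h * g * h⁻¹)⁻¹ = h * g⁻¹ * h⁻¹ by group]
  simp only [Int.cast_inj] at h1 h2
  rw [h1, h2]

theorem restrict_mem_virtualChar {F : Equiv.Perm (Fin 6) → ℤ}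
    (hF : (fun g => (F g : ℂ)) ∈ virtualChar (Equiv.Perm (Fin 6))) :
    (fun g : alternatingGroup (Fin 6) => (F g : ℂ)) ∈ virtualChar (alternatingGroup (Fin 6)) :=
  comp_mem_virtualChar (alternatingGroup (Fin 6)).subtype hF

theorem sixPointChar_mem_Irr (i : Fin 5) :
    (fun g : alternatingGroup (Fin 6) => (sixPointChar i g : ℂ)) ∈
      Irr (alternatingGroup (Fin 6)) := by
  refine intCast_mem_Irr (restrict_mem_virtualChar (sixPointChar_mem_virtualChar i)) ?_ ?_
  · rw [sum_mul_inv_alternatingGroup_six (sixPointChar_mem_virtualChar i)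
      (sixPointChar_mem_virtualChar i), card_alternatingGroup_six]
    revert i
    decide +kernel
  · revert i
    decide +kernel

theorem charInner_intCast_alternatingGroup_six {F F' : Equiv.Perm (Fin 6) → ℤ}
    (hF : (fun g => (F g : ℂ)) ∈ virtualChar (Equiv.Perm (Fin 6)))
    (hF' : (fun g => (F' g : ℂ)) ∈ virtualChar (Equiv.Perm (Fin 6))) {c : ℤ}
    (h : ∑ i, evenCycleCount i * (F (evenCycleRep i) * F' (evenCycleRep i)⁻¹) = 360 * c) :
    charInner (fun g : alternatingGroup (Fin 6) => (F g : ℂ)) (fun g => (F' g : ℂ)) = c := by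
  rw [← sum_mul_inv_alternatingGroup_six hF hF'] at h
  have h2 : ∑ g : alternatingGroup (Fin 6), (F g : ℂ) * F' (g⁻¹ : alternatingGroup (Fin 6)) =
      360 * c := by exact_mod_cast h
  rw [charInner, h2, Nat.card_eq_fintype_card, card_alternatingGroup_six]
  push_cast
  ring

/-- If `f` is a virtual character orthogonal to the irreducible characters in `K`, whose norm,
degree and the squared degrees outside `K` satisfy the equality case of the Cauchy–Schwarz
inequality, then the degrees outside `K` are multiples of the multiplicities in `f`. -/
theorem le_degree_of_cauchySchwarz_eq {G : Type*} [Group G] [Fintype G] {f : G → ℂ}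
    (hf : f ∈ virtualChar G) {K : Finset (G → ℂ)} (hK : ∀ χ ∈ K, χ ∈ Irr G)
    (horth : ∀ χ ∈ K, charInner f χ = 0) {c n : ℕ} (hnorm : charInner f f = n)
    (hdeg : f 1 = c * n) (hsq : ∑ χ ∈ K, (χ 1).re ^ 2 + c ^ 2 * n = Nat.card G) {χ : G → ℂ}
    (hχ : χ ∈ Irr G) (hχK : χ ∉ K) : (c : ℝ) ≤ (χ 1).re := by
  classical
  have hsub : K ⊆ irrFinset G := fun χ h => mem_irrFinset.2 (hK χ h)
  obtain ⟨m, hm⟩ := exists_eq_sum_of_mem_virtualChar hf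
  have hm0 : ∀ χ ∈ K, m χ = 0 := fun χ h => by
    have h1 := charInner_sum_irr (fun χ => (m χ : ℂ)) (hK χ h)
    rw [← hm, horth χ h] at h1
    exact_mod_cast h1.symm
  have hnorm' : ∑ χ ∈ irrFinset G \ K, (m χ : ℝ) * m χ = n := by
    have h1 := charInner_sum_sum_irr (fun χ => (m χ : ℂ)) (fun χ => (m χ : ℂ))
    rw [← hm, hnorm, ← Finset.sum_sdiff hsub, Finset.sum_eq_zero (s := K), add_zero] at h1
    · exact_mod_cast h1.symm
    · intro χ h
      simp [hm0 χ h]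
  have hdeg' : ∑ χ ∈ irrFinset G \ K, (m χ : ℝ) * (χ 1).re = c * n := by
    have h1 := congrArg Complex.re (congrFun hm 1)
    rw [hdeg, Finset.sum_apply, ← Finset.sum_sdiff hsub, Finset.sum_eq_zero (s := K), add_zero,
      Complex.re_sum] at h1
    · simpa using h1.symm
    · intro χ h
      simp [hm0 χ h]
  have hsq' : ∑ χ ∈ irrFinset G \ K, (χ 1).re ^ 2 = c ^ 2 * n := by
    have h1 := Finset.sum_sdiff (f := fun χ : G → ℂ => (χ 1).re ^ 2) hsub
    rw [sum_irr_sq] at h1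
    linarith
  -- Expanding the square gives c²n - 2c·cn + c²n = 0, so every degree outside K equals c times its
  -- multiplicity.
  have hzero : ∑ χ ∈ irrFinset G \ K, ((χ 1).re - c * m χ) ^ 2 = 0 := by
    have h1 : ∀ χ : G → ℂ, ((χ 1).re - c * m χ) ^ 2 =
        (χ 1).re ^ 2 - 2 * c * (m χ * (χ 1).re) + c ^ 2 * (m χ * m χ) := fun χ => by ring
    simp only [h1]
    rw [Finset.sum_add_distrib, Finset.sum_sub_distrib, ← Finset.mul_sum, ← Finset.mul_sum,
      hnorm', hdeg', hsq']
    ring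
  rw [Finset.sum_eq_zero_iff_of_nonneg fun _ _ => sq_nonneg _] at hzero
  have h2 := sub_eq_zero.1 (pow_eq_zero_iff two_ne_zero |>.1
    (hzero χ (Finset.mem_sdiff.2 ⟨mem_irrFinset.2 hχ, hχK⟩)))
  have h3 := re_apply_one_pos hχ
  rw [h2] at h3 ⊢
  have h4 : (0 : ℝ) < m χ := pos_of_mul_pos_right h3 (Nat.cast_nonneg c)
  have h5 : (1 : ℝ) ≤ m χ := by exact_mod_cast (Int.cast_pos.1 h4)
  exact le_mul_of_one_le_right (Nat.cast_nonneg c) h5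

/-- The known characters contribute at most 1/360 + 1/5 + 1/5 + 1/9 + 1/10 and the rest at most 1/4,
about 0.864 in total. -/
theorem fcod_alternatingGroup_six_lt_one : fcod (alternatingGroup (Fin 6)) < 1 := by
  classical
  let χ : Fin 5 → alternatingGroup (Fin 6) → ℂ := fun i g => (sixPointChar i g : ℂ)
  have hinj : Function.Injective χ := by
    intro i j h
    -- Degrees separate all but the two characters of degree 5, which take the values 2 and -1 on a
    -- 3-cycle.
    let g : Fin 2 → alternatingGroup (Fin 6) := ![1, ⟨c[0, 1, 2],
      Equiv.Perm.mem_alternatingGroup.2 (by decide +kernel)⟩]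
    have h1 : ∀ k, sixPointChar i (g k) = sixPointChar j (g k) := fun k => by
      have h2 : (sixPointChar i (g k) : ℂ) = sixPointChar j (g k) := congrFun h (g k)
      exact_mod_cast h2
    revert h1
    clear h
    revert i j
    decide +kernel
  let K := Finset.univ.image χ
  have hK : ∀ θ ∈ K, θ ∈ Irr (alternatingGroup (Fin 6)) := by
    intro θ hθ
    obtain ⟨i, -, rfl⟩ := Finset.mem_image.1 hθ
    exact sixPointChar_mem_Irr i
  have hcard : (Nat.card (alternatingGroup (Fin 6)) : ℝ) = 360 := by
    rw [Nat.card_eq_fintype_card, card_alternatingGroup_six]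
    norm_num
  have hdeg : ∀ i, (χ i 1).re = (![1, 5, 5, 9, 10] i : ℝ) := by
    intro i
    have h : sixPointChar i 1 = ![1, 5, 5, 9, 10] i := by
      revert i
      decide +kernel
    change ((sixPointChar i 1 : ℂ)).re = _
    rw [h, Complex.intCast_re]
    fin_cases i <;> simp
  -- The five known degrees account for 232 of 360. The remaining 128 = 8²·2 matches norm 2 and
  -- degree 16 = 8·2.
  have hsq : ∑ θ ∈ K, (θ 1).re ^ 2 + ((8 : ℕ) : ℝ) ^ 2 * ((2 : ℕ) : ℝ) =
      Nat.card (alternatingGroup (Fin 6)) := by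
    rw [hcard, Finset.sum_image hinj.injOn]
    simp only [hdeg, Fin.sum_univ_five, Matrix.cons_val]
    norm_num
  have hle : ∀ θ ∈ irrFinset (alternatingGroup (Fin 6)) \ K, (8 : ℝ) ≤ (θ 1).re := by
    intro θ hθ
    rw [Finset.mem_sdiff] at hθ
    have := le_degree_of_cauchySchwarz_eq
      (restrict_mem_virtualChar sixPointSumChar_mem_virtualChar) hK ?_ (c := 8) (n := 2) ?_ ?_ hsq
      (mem_irrFinset.1 hθ.1) hθ.2
    · exact_mod_cast this
    · intro θ hθ
      obtain ⟨i, -, rfl⟩ := Finset.mem_image.1 hθ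
      rw [charInner_intCast_alternatingGroup_six (c := 0) sixPointSumChar_mem_virtualChar
        (sixPointChar_mem_virtualChar i), Int.cast_zero]
      clear hθ
      revert i
      decide +kernel
    · rw [charInner_intCast_alternatingGroup_six (c := 2) sixPointSumChar_mem_virtualChar
        sixPointSumChar_mem_virtualChar]
      · norm_num
      · decide +kernel
    · have h : sixPointSumChar 1 = 16 := by decide +kernel
      change (sixPointSumChar 1 : ℂ) = _
      rw [h]
      norm_num
  have hsub : K ⊆ irrFinset (alternatingGroup (Fin 6)) := fun θ h => mem_irrFinset.2 (hK θ h)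
  have hsq' : ∑ θ ∈ irrFinset (alternatingGroup (Fin 6)) \ K, (θ 1).re ^ 2 = 128 := by
    have h1 := Finset.sum_sdiff (f := fun θ : alternatingGroup (Fin 6) → ℂ => (θ 1).re ^ 2) hsub
    rw [sum_irr_sq] at h1
    push_cast at hsq
    linarith
  have hker : ∀ θ : alternatingGroup (Fin 6) → ℂ, (1 : ℝ) ≤ (charKer θ).ncard := fun θ => by
    exact_mod_cast ncard_charKer_pos θ
  have hrest : ∑ θ ∈ irrFinset (alternatingGroup (Fin 6)) \ K,
      1 / ((charKer θ).ncard * (θ 1).re) ≤ 1 / 4 := by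
    -- For d ≥ 8 one has 1/d ≤ d²/8³, which turns the known sum of squares 128 into a bound without
    -- counting the characters.
    calc _ ≤ ∑ θ ∈ irrFinset (alternatingGroup (Fin 6)) \ K, (θ 1).re ^ 2 / 512 := by
          refine Finset.sum_le_sum fun θ hθ => ?_
          have h8 := hle θ hθ
          have hp : 0 < (θ 1).re := by linarith
          have h1 : (θ 1).re ≤ (charKer θ).ncard * (θ 1).re :=
            le_mul_of_one_le_left hp.le (hker θ)
          refine (one_div_le_one_div_of_le hp h1).trans ?_
          rw [div_le_div_iff₀ hp (by norm_num)]
          have h3 : (8 : ℝ) ^ 3 ≤ (θ 1).re ^ 3 := pow_le_pow_left₀ (by norm_num) h8 3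
          linarith [h3, pow_succ (θ 1).re 2]
      _ = 1 / 4 := by
          rw [← Finset.sum_div, hsq']
          norm_num
  have htriv : ((charKer (χ 0)).ncard : ℝ) = 360 := by
    have h1 : charKer (χ 0) = Set.univ := by
      ext g
      simp [charKer, χ, sixPointChar]
    rw [h1, Set.ncard_univ, hcard]
  have hknown : ∑ θ ∈ K, 1 / ((charKer θ).ncard * (θ 1).re) ≤
      1 / 360 + 1 / 5 + 1 / 5 + 1 / 9 + 1 / 10 := by
    rw [Finset.sum_image hinj.injOn]
    simp only [hdeg, Fin.sum_univ_five, htriv]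
    -- Bounding kernels below by 1 is enough for the nontrivial characters. Only the trivial one
    -- needs its actual kernel.
    have h : ∀ (i : Fin 5) (d : ℝ), 0 < d → 1 / ((charKer (χ i)).ncard * d) ≤ 1 / d :=
      fun i d hd => one_div_le_one_div_of_le hd (le_mul_of_one_le_left hd.le (hker _))
    have e1 := h 1 5 (by norm_num)
    have e2 := h 2 5 (by norm_num)
    have e3 := h 3 9 (by norm_num)
    have e4 := h 4 10 (by norm_num)
    simp only [Matrix.cons_val, mul_one]
    linarith
  rw [fcod_eq_sum, ← Finset.sum_sdiff hsub]
  norm_num at hknown hrest ⊢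
  linarith

theorem mainTheorem2 :
    -- (1) solvable families: direct powers of `C₈ ⋊ C₂²`, and dihedral groups of order `2 ^ n`
    ((∀ n : ℕ, Group.IsSolvable (Fin (n + 1) → HolC8)) ∧
      Tendsto (fun n : ℕ => Nat.card (Fin (n + 1) → HolC8)) atTop atTop ∧
      Tendsto (fun n : ℕ => fcod (Fin (n + 1) → HolC8)) atTop (𝓝 0)) ∧
    ((∀ n : ℕ, Group.IsSolvable (DihedralGroup (2 ^ (n + 2)))) ∧
      Tendsto (fun n : ℕ => Nat.card (DihedralGroup (2 ^ (n + 2)))) atTop atTop ∧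
      Tendsto (fun n : ℕ => fcod (DihedralGroup (2 ^ (n + 2)))) atTop atTop) ∧
    -- (2) non-solvable families: direct powers of `A₆`, and `A₅ × C_p` for primes `p > 5`
    ((∀ n : ℕ, ¬ Group.IsSolvable (Fin (n + 1) → alternatingGroup (Fin 6))) ∧
      Tendsto (fun n : ℕ => Nat.card (Fin (n + 1) → alternatingGroup (Fin 6))) atTop atTop ∧
      Tendsto (fun n : ℕ => fcod (Fin (n + 1) → alternatingGroup (Fin 6))) atTop (𝓝 0)) ∧
    ((∀ p : {p : ℕ // p.Prime ∧ 5 < p},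
        ¬ Group.IsSolvable (alternatingGroup (Fin 5) × Multiplicative (ZMod p))) ∧
      Tendsto (fun p : {p : ℕ // p.Prime ∧ 5 < p} =>
        Nat.card (alternatingGroup (Fin 5) × Multiplicative (ZMod p))) atTop atTop ∧
      Tendsto (fun p : {p : ℕ // p.Prime ∧ 5 < p} =>
        fcod (alternatingGroup (Fin 5) × Multiplicative (ZMod p))) atTop atTop) := by
  have : Nontrivial HolC8 := Finite.one_lt_card_iff_nontrivial.1 (by rw [card_HolC8]; norm_num)
  have : Nontrivial (alternatingGroup (Fin 6)) := Finite.one_lt_card_iff_nontrivial.1 (by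
    rw [Nat.card_eq_fintype_card, card_alternatingGroup_six]
    norm_num)
  refine ⟨⟨isSolvable_pow_HolC8, tendsto_card_pow, tendsto_fcod_pow fcod_HolC8_lt_one⟩,
    ⟨isSolvable_dihedral, tendsto_card_dihedral, tendsto_fcod_dihedral⟩,
    ⟨not_isSolvable_pow (not_isSolvable_alternatingGroup (by norm_num)), tendsto_card_pow,
      tendsto_fcod_pow fcod_alternatingGroup_six_lt_one⟩,
    ⟨fun p => not_isSolvable_prod (not_isSolvable_alternatingGroup le_rfl),
      tendsto_card_prod_cyclic _, tendsto_fcod_prod_cyclic _⟩⟩
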